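/- Let $\mathcal H,\mathcal H'$ be finite-dimensional complex Hilbert spaces, $\mathcal H\neq 0$, and write $\mathcal D$ for the set of states (density operators) on $\mathcal H$. For a state $\rho$ put $S(\rho)=-\mathrm{tr}\{\rho\ln\rho\}$, and for states $\rho,\varphi$ put $S(\rho\Vert\varphi)=\mathrm{tr}\{\rho(\ln\rho-\ln\varphi)\}$ if $\mathrm{supp}\,\rho\subseteq\mathrm{supp}\,\varphi$ and $S(\rho\Vert\varphi)=\infty$ otherwise. For a positive trace-preserving linear map $\Phi$ from operators on $\mathcal H$ to operators on $\mathcal H'$ (in particular for a quantum channel) define $$\Lambda(\Phi)=\inf_{\varphi\in\mathcal D}\ \sup_{\rho\in\mathcal D}\ \bigl[S(\rho\Vert\varphi)-S(\Phi(\rho)\Vert\Phi(\varphi))\bigr]\in[0,\infty],$$ where $\infty-\infty$ is read as $0$. A physical process that implements $\Phi$, and its entropy production (EP) $\Sigma$, are given in one of two ways: (a) by a linear entropy flow $Q:\mathcal D\to\mathbb R\cup\{\infty\}$, i.e. $Q((1-t)\varphi+t\rho)=(1-t)Q(\varphi)+tQ(\rho)$ for $0<t<1$, such that $\Sigma(\rho)=S(\Phi(\rho))-S(\rho)+Q(\rho)$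 satisfies the second law $\Sigma(\rho)\ge 0$ for all $\rho\in\mathcal D$; or (b) by a finite-dimensional environment $\mathcal H_Y$ with initial state $\omega$ and an isometry $V:\mathcal H\otimes\mathcal H_Y\to\mathcal H'\otimes\mathcal H_Y$ (a unitary, if $\mathcal H'=\mathcal H$) such that $\Phi(\rho)=\mathrm{tr}_Y\{V(\rho\otimes\omega)V^\dagger\}$ for all $\rho\in\mathcal D$, with $\Sigma(\rho)=S\bigl(V(\rho\otimes\omega)V^\dagger\,\Vert\,\Phi(\rho)\otimes\omega\bigr)$. Then: 1. For every $\Phi$ and every physical process that implements $\Phi$ there is an initial state $\rho\in\mathcal D$ with $\Sigma(\rho)\ge\Lambda(\Phi)$. 2. $\Lambda(\Phi)=0$ for every unitary channel $\Phi(\rho)=U\rho U^\dagger$. 3. For the qubit reset channel, $\Phi(\rho)=|0\rangle\langle 0|$ for all states $\rho$ of a qubit, $\Lambda(\Phi)=\ln 2$. Hence for every physical process that implements qubit reset there is an initial state $\rho$ with $\Sigma(\rho)\ge\ln 2$. -/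

import Mathlib

open scoped Matrix Kronecker ComplexOrder

noncomputable section

namespace LogIrrev

/-- The states (density operators) of a finite-dimensional quantum system with orthonormal
basis indexed by `n`: positive semidefinite matrices of unit trace. -/
abbrev State (n : Type*) [Fintype n] : Type _ :=
  {ρ : Matrix n n ℂ // ρ.PosSemidef ∧ ρ.trace = 1}

/-- The support of an operator: the orthogonal complement of its kernel. -/
def supp {n : Type*} [Fintype n] [DecidableEq n] (A : Matrix n n ℂ) :
    Submodule ℂ (EuclideanSpace ℂ n) :=
  (LinearMap.ker (Matrix.toEuclideanLin A))ᗮ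

/-- The operator logarithm of a Hermitian matrix, through its spectral decomposition. Zero
eigenvalues are sent to `0`, which gives the convention `0 ln 0 = 0` below. -/
def matLog {n : Type*} [Fintype n] [DecidableEq n] (A : Matrix n n ℂ) : Matrix n n ℂ :=
  cfc Real.log A

/-- Von Neumann entropy `S(ρ) = - tr (ρ ln ρ)`. -/
def entropy {n : Type*} [Fintype n] [DecidableEq n] (ρ : State n) : ℝ :=
  -(ρ.1 * matLog ρ.1).trace.re

open Classical in
/-- Quantum relative entropy `S(ρ‖φ)`, of matrices: `tr (ρ (ln ρ - ln φ))` if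
`supp ρ ⊆ supp φ`, and `∞` otherwise. -/
def relEnt {n : Type*} [Fintype n] [DecidableEq n] (ρ φ : Matrix n n ℂ) : EReal :=
  if supp ρ ≤ supp φ then (((ρ * (matLog ρ - matLog φ)).trace.re : ℝ) : EReal) else ⊤

/-- Positive trace-preserving linear maps; every quantum channel is one. Input and output
space may differ. -/
structure Channel (n m : Type*) [Fintype n] [Fintype m] where
  toLin : Matrix n n ℂ →ₗ[ℂ] Matrix m m ℂ
  pos : ∀ A : Matrix n n ℂ, A.PosSemidef → (toLin A).PosSemidef
  tr : ∀ A : Matrix n n ℂ, (toLin A).trace = A.trace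

/-- The action `ρ ↦ Φ(ρ)` of a channel on states. -/
def Channel.app {n m : Type*} [Fintype n] [Fintype m] (Φ : Channel n m) (ρ : State n) :
    State m :=
  ⟨Φ.toLin ρ.1, Φ.pos _ ρ.2.1, (Φ.tr _).trans ρ.2.2⟩

open Classical in
/-- The contraction of relative entropy `-ΔS(ρ‖φ) = S(ρ‖φ) - S(Φ(ρ)‖Φ(φ))`. If
`S(Φ(ρ)‖Φ(φ)) = ∞`, then also `S(ρ‖φ) = ∞`, and `∞ - ∞` is read as `0`; since the
pair `ρ = φ` has contraction `0`, such pairs have no influence on the supremum over `ρ`. -/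
def contraction {n m : Type*} [Fintype n] [DecidableEq n] [Fintype m] [DecidableEq m]
    (Φ : Channel n m) (ρ φ : State n) : EReal :=
  if relEnt (Φ.app ρ).1 (Φ.app φ).1 = ⊤ then 0
  else relEnt ρ.1 φ.1 - relEnt (Φ.app ρ).1 (Φ.app φ).1

/-- The measure of logical irreversibility `Λ(Φ) = inf_φ sup_ρ [S(ρ‖φ) - S(Φ(ρ)‖Φ(φ))]`. -/
def logIrr {n m : Type*} [Fintype n] [DecidableEq n] [Fintype m] [DecidableEq m]
    (Φ : Channel n m) : EReal :=
  ⨅ φ : State n, ⨆ ρ : State n, contraction Φ ρ φ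

/-- Linear functionals on states with values in `ℝ ∪ {∞}`: maps that respect convex mixtures. -/
def IsLinearFunctional {n : Type*} [Fintype n] (Q : State n → EReal) : Prop :=
  (∀ ρ, Q ρ ≠ ⊥) ∧
  ∀ (ρ φ σ : State n) (t : ℝ), 0 < t → t < 1 →
    σ.1 = ((1 - t : ℝ) : ℂ) • φ.1 + (t : ℂ) • ρ.1 →
    Q σ = ((1 - t : ℝ) : EReal) * Q φ + (t : EReal) * Q ρ

/-- Entropy production as increase of the system's entropy plus entropy flow:
`S(Φ(ρ)) - S(ρ) + Q(ρ)`. -/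
def flowEP {n m : Type*} [Fintype n] [DecidableEq n] [Fintype m] [DecidableEq m]
    (Φ : Channel n m) (Q : State n → EReal) (ρ : State n) : EReal :=
  ((entropy (Φ.app ρ) - entropy ρ : ℝ) : EReal) + Q ρ

/-- The joint final state `V (ρ ⊗ ω) V†` of system and environment. -/
def jointState {n m e : Type*} [Fintype n] [Fintype e]
    (V : Matrix (m × e) (n × e) ℂ) (ω : State e) (ρ : State n) : Matrix (m × e) (m × e) ℂ :=
  V * (ρ.1 ⊗ₖ ω.1) * Vᴴ

/-- The partial trace over the environment (second factor). -/
def trEnv {m e : Type*} [Fintype e] (A : Matrix (m × e) (m × e) ℂ) : Matrix m m ℂ :=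
  Matrix.of fun i j => ∑ y, A (i, y) (j, y)

/-- A physical process that implements the map `Φ`, in one of two descriptions.
* `flow`: a linear entropy flow function `Q` (the increase of the entropy of the reservoirs)
  for which the second law `Σ ≥ 0` holds.
* `dilation`: an explicit environment with initial state `ω`, and a joint evolution
  `ρ ⊗ ω ↦ V (ρ ⊗ ω) V†` by an isometry `V` (a unitary, if input and output
  space of the system agree) whose reduced dynamics on the system is `Φ`. -/
inductive PhysicalProcess {n m : Type*} [Fintype n] [DecidableEq n] [Fintype m] [DecidableEq m]
    (Φ : Channel n m) where
  | flow (Q : State n → EReal) (linear : IsLinearFunctional Q)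
      (second_law : ∀ ρ, 0 ≤ flowEP Φ Q ρ)
  | dilation (k : ℕ) (ω : State (Fin k)) (V : Matrix (m × Fin k) (n × Fin k) ℂ)
      (isometry : Vᴴ * V = 1)
      (implements : ∀ ρ : State n, (Φ.app ρ).1 = trEnv (jointState V ω ρ))

/-- The entropy production `Σ(ρ)` of a physical process started in `ρ`:
`S(Φ(ρ)) - S(ρ) + Q(ρ)` in the first description,
`S(V (ρ ⊗ ω) V† ‖ Φ(ρ) ⊗ ω)` in the second. -/
def PhysicalProcess.ep {n m : Type*} [Fintype n] [DecidableEq n] [Fintype m] [DecidableEq m]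
    {Φ : Channel n m} : PhysicalProcess Φ → State n → EReal
  | .flow Q _ _, ρ => flowEP Φ Q ρ
  | .dilation _ ω V _ _, ρ => relEnt (jointState V ω ρ) ((Φ.app ρ).1 ⊗ₖ ω.1)

/-- The unitary channel `ρ ↦ U ρ U†`. -/
def unitaryChannel {n : Type*} [Fintype n] [DecidableEq n] (U : Matrix.unitaryGroup n ℂ) :
    Channel n n where
  toLin :=
    { toFun := fun A => (U : Matrix n n ℂ) * A * (U : Matrix n n ℂ)ᴴ
      map_add' := fun A B => by rw [Matrix.mul_add, Matrix.add_mul]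
      map_smul' := fun c A => by simp }
  pos := fun A hA => hA.mul_mul_conjTranspose_same _
  tr := fun A => by
    have h : (U : Matrix n n ℂ)ᴴ * (U : Matrix n n ℂ) = 1 := by
      rw [← Matrix.star_eq_conjTranspose]; exact Unitary.star_mul_self_of_mem U.2
    change ((U : Matrix n n ℂ) * A * (U : Matrix n n ℂ)ᴴ).trace = A.trace
    rw [Matrix.trace_mul_comm, ← Matrix.mul_assoc, h, Matrix.one_mul]

/-- The projection `|0⟩⟨0|` of a qubit. -/
def ketbra0 : Matrix (Fin 2) (Fin 2) ℂ := Matrix.diagonal ![1, 0]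

/-- The qubit reset channel `A ↦ tr(A) |0⟩⟨0|`, so that every state goes to `|0⟩⟨0|`. -/
def resetChannel : Channel (Fin 2) (Fin 2) where
  toLin :=
    { toFun := fun A => A.trace • ketbra0
      map_add' := fun A B => by rw [Matrix.trace_add, add_smul]
      map_smul' := fun c A => by simp [mul_smul] }
  pos := fun A hA => by
    refine Matrix.PosSemidef.smul ?_ hA.trace_nonneg
    refine Matrix.PosSemidef.diagonal ?_
    intro i
    fin_cases i <;> simp
  tr := fun A => by simp [ketbra0, Matrix.trace_fin_two]

end LogIrrev

end

/-! If $\Sigma$ is infinite at some state, that state proves the bound. Otherwise both descriptions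
of a process give $\Sigma(\rho)=S(\Phi(\rho))-S(\rho)+L(\rho)$ with $L$ real linear. Since $L$ is
linear, the deviation of $\Sigma$ from affinity along a segment comes from entropies alone, hence
from relative entropies.

$\Sigma$ is continuous on the compact set of states, so it has a minimizer $\varphi$. Comparing
$\Sigma(\varphi)$ with $\Sigma$ at $(1-t)\varphi+t\rho$, dividing by $t$ and letting $t\to0$ yields
$\Sigma(\rho)-\Sigma(\varphi)\ge S(\rho\Vert\varphi)-S(\Phi(\rho)\Vert\Phi(\varphi))$. As
$\Sigma(\varphi)\ge0$, every contraction towards $\varphi$ is at most $\Sigma(\rho)\le\max\Sigma$,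
and the infimum defining $\Lambda$ is bounded by its value at $\varphi$ (`contraction_le_realEP`,
`exists_logIrr_le_realEP`). The supporting facts are Klein's inequality, an upper semicontinuity
argument that copes with singular $\varphi$, and the linear extension of affine functionals
(`exists_linear_extension`).

Unitary channels preserve relative entropy, so all contractions vanish. Reset makes the output
relative entropy vanish, so $\Lambda=\inf_\varphi\sup_\rho S(\rho\Vert\varphi)$, attained at the
maximally mixed state. -/

open Filter Topology

set_option linter.unusedSectionVars false

namespace LogIrrev

/-! ### Spectral calculus in an explicit eigenbasis, supports, and Klein's inequality. -/

section

variable {n m : Type*} [Fintype n] [DecidableEq n] [Fintype m] [DecidableEq m]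

/-- The Hermitian matrix with eigenvalues `d` and eigenvectors the columns of `U`. -/
noncomputable def conjDiag (U : Matrix.unitaryGroup n ℂ) (d : n → ℝ) : Matrix n n ℂ :=
  (U : Matrix n n ℂ) * Matrix.diagonal (fun i => (d i : ℂ)) * star (U : Matrix n n ℂ)

/-- The diagonal entries of `A` in the orthonormal basis given by the columns of `U`. -/
noncomputable def weight (U : Matrix.unitaryGroup n ℂ) (A : Matrix n n ℂ) (i : n) : ℝ :=
  ((star (U : Matrix n n ℂ) * A * (U : Matrix n n ℂ)) i i).re

/-- `re tr (A ln B)`. -/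
noncomputable def crossLog (A B : Matrix n n ℂ) : ℝ := (A * matLog B).trace.re

theorem exists_eq_conjDiag {A : Matrix n n ℂ} (hA : A.IsHermitian) :
    ∃ U d, A = conjDiag U d :=
  ⟨hA.eigenvectorUnitary, hA.eigenvalues, by
    conv_lhs => rw [hA.spectral_theorem]
    rfl⟩

theorem star_mul_conjDiag_mul (U : Matrix.unitaryGroup n ℂ) (d : n → ℝ) :
    star (U : Matrix n n ℂ) * conjDiag U d * (U : Matrix n n ℂ)
      = Matrix.diagonal (fun i => (d i : ℂ)) := by
  have h : star (U : Matrix n n ℂ) * (U : Matrix n n ℂ) = 1 := Unitary.star_mul_self_of_mem U.2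
  rw [conjDiag]
  calc _ = (star (U : Matrix n n ℂ) * U) * Matrix.diagonal (fun i => (d i : ℂ))
        * (star (U : Matrix n n ℂ) * U) := by simp only [Matrix.mul_assoc]
    _ = _ := by rw [h, Matrix.one_mul, Matrix.mul_one]

theorem isHermitian_conjDiag (U : Matrix.unitaryGroup n ℂ) (d : n → ℝ) :
    (conjDiag U d).IsHermitian :=
  Matrix.isHermitian_mul_mul_conjTranspose _ (by
    rw [Matrix.IsHermitian, Matrix.diagonal_conjTranspose]
    congr 1
    funext i
    simp)

theorem conjDiag_nonneg {U : Matrix.unitaryGroup n ℂ} {d : n → ℝ}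
    (h : (conjDiag U d).PosSemidef) (i : n) : 0 ≤ d i := by
  have h1 := h.conjTranspose_mul_mul_same (U : Matrix n n ℂ)
  rw [← Matrix.star_eq_conjTranspose, star_mul_conjDiag_mul] at h1
  have := h1.diag_nonneg (i := i)
  simpa using this

theorem weight_nonneg {A : Matrix n n ℂ} (hA : A.PosSemidef) (U : Matrix.unitaryGroup n ℂ)
    (i : n) : 0 ≤ weight U A i := by
  have h1 := hA.conjTranspose_mul_mul_same (U : Matrix n n ℂ)
  exact (Complex.le_def.1 (h1.diag_nonneg (i := i))).1

theorem sum_weight (U : Matrix.unitaryGroup n ℂ) (A : Matrix n n ℂ) :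
    ∑ i, weight U A i = A.trace.re := by
  have h : (U : Matrix n n ℂ) * star (U : Matrix n n ℂ) = 1 := Unitary.mul_star_self_of_mem U.2
  have h2 : (star (U : Matrix n n ℂ) * A * (U : Matrix n n ℂ)).trace = A.trace := by
    rw [Matrix.trace_mul_comm, ← Matrix.mul_assoc, h, Matrix.one_mul]
  rw [← h2, Matrix.trace, Complex.re_sum]
  rfl

theorem trace_mul_conjDiag (A : Matrix n n ℂ) (U : Matrix.unitaryGroup n ℂ) (d : n → ℝ) :
    (A * conjDiag U d).trace.re = ∑ i, weight U A i * d i := by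
  have h2 : (A * conjDiag U d).trace = (star (U : Matrix n n ℂ) * A * (U : Matrix n n ℂ)
      * Matrix.diagonal (fun i => (d i : ℂ))).trace := by
    rw [conjDiag, ← Matrix.mul_assoc, Matrix.trace_mul_comm]
    simp only [Matrix.mul_assoc]
  rw [h2, Matrix.trace, Complex.re_sum]
  refine Finset.sum_congr rfl fun i _ => ?_
  rw [Matrix.diag_apply, Matrix.mul_diagonal, Complex.re_mul_ofReal, weight]

theorem weight_self (U : Matrix.unitaryGroup n ℂ) (d : n → ℝ) (i : n) :
    weight U (conjDiag U d) i = d i := by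
  rw [weight, star_mul_conjDiag_mul]
  simp

/-- The squared overlaps of two orthonormal bases form a doubly stochastic matrix; this reduces
trace inequalities for non-commuting matrices to scalar ones. -/
theorem weight_conjDiag (U W : Matrix.unitaryGroup n ℂ) (p : n → ℝ) (i : n) :
    weight U (conjDiag W p) i
      = ∑ k, Complex.normSq ((star (U : Matrix n n ℂ) * (W : Matrix n n ℂ)) i k) * p k := by
  set M := star (U : Matrix n n ℂ) * (W : Matrix n n ℂ) with hM
  have h : star (U : Matrix n n ℂ) * conjDiag W p * (U : Matrix n n ℂ)
      = M * Matrix.diagonal (fun k => (p k : ℂ)) * star M := by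
    rw [hM, star_mul, star_star, conjDiag]
    simp only [Matrix.mul_assoc]
  rw [weight, h, Matrix.mul_apply, Complex.re_sum]
  refine Finset.sum_congr rfl fun k _ => ?_
  rw [Matrix.mul_diagonal, Matrix.star_apply, mul_right_comm, Complex.re_mul_ofReal,
    Complex.star_def, Complex.mul_conj, Complex.ofReal_re]

theorem sum_normSq_unitary_row (V : Matrix.unitaryGroup n ℂ) (i : n) :
    ∑ k, Complex.normSq ((V : Matrix n n ℂ) i k) = 1 := by
  have h : (V : Matrix n n ℂ) * star (V : Matrix n n ℂ) = 1 := Unitary.mul_star_self_of_mem V.2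
  have h2 := congrFun (congrFun h i) i
  rw [Matrix.mul_apply, Matrix.one_apply_eq] at h2
  have h3 := congrArg Complex.re h2
  rw [Complex.re_sum, Complex.one_re] at h3
  rw [← h3]
  refine Finset.sum_congr rfl fun k _ => ?_
  rw [Matrix.star_apply, Complex.star_def, Complex.mul_conj, Complex.ofReal_re]

theorem sum_normSq_unitary_col (V : Matrix.unitaryGroup n ℂ) (k : n) :
    ∑ i, Complex.normSq ((V : Matrix n n ℂ) i k) = 1 := by
  rw [← sum_normSq_unitary_row (star V) k]
  refine Finset.sum_congr rfl fun i _ => ?_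
  rw [Unitary.coe_star, Matrix.star_apply, Complex.star_def, Complex.normSq_conj]

theorem exists_polynomial_eval_eq (f : ℝ → ℝ) (s : Finset ℝ) :
    ∃ q : Polynomial ℝ, ∀ x ∈ s, q.eval x = f x :=
  ⟨Lagrange.interpolate s id f, fun _ hx =>
    Lagrange.eval_interpolate_at_node (v := id) f (Set.injOn_id _) hx⟩

theorem aeval_conjDiag (U : Matrix.unitaryGroup n ℂ) (d : n → ℝ) (q : Polynomial ℝ) :
    Polynomial.aeval (conjDiag U d) q = conjDiag U (fun i => q.eval (d i)) := by
  have h : star (U : Matrix n n ℂ) * (U : Matrix n n ℂ) = 1 := Unitary.star_mul_self_of_mem U.2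
  have h' : (U : Matrix n n ℂ) * star (U : Matrix n n ℂ) = 1 := Unitary.mul_star_self_of_mem U.2
  have hmul : ∀ a b : n → ℝ, conjDiag U a * conjDiag U b = conjDiag U (fun i => a i * b i) := by
    intro a b
    calc conjDiag U a * conjDiag U b
        = (U : Matrix n n ℂ) * Matrix.diagonal (fun i => (a i : ℂ))
          * (star (U : Matrix n n ℂ) * U)
          * Matrix.diagonal (fun i => (b i : ℂ)) * star (U : Matrix n n ℂ) := by
            simp only [conjDiag, Matrix.mul_assoc]
      _ = _ := by
        rw [h, Matrix.mul_one, Matrix.mul_assoc (U : Matrix n n ℂ), Matrix.diagonal_mul_diagonal]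
        simp [conjDiag]
  have hC : ∀ c : ℝ, algebraMap ℝ (Matrix n n ℂ) c = conjDiag U (fun _ => c) := by
    intro c
    have : (Matrix.diagonal (fun _ : n => (c : ℂ))) = (c : ℂ) • (1 : Matrix n n ℂ) := by
      rw [Matrix.smul_one_eq_diagonal]
    rw [conjDiag, this, Matrix.mul_smul, Matrix.smul_mul, Matrix.mul_one, h',
      Algebra.algebraMap_eq_smul_one]
    ext i j
    simp
  induction q using Polynomial.induction_on' with
  | add p r hp hr =>
    rw [map_add, hp, hr, conjDiag, conjDiag, conjDiag, ← Matrix.add_mul, ← Matrix.mul_add,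
      Matrix.diagonal_add]
    simp
  | monomial k c =>
    rw [Polynomial.aeval_monomial, hC]
    have : ∀ k : ℕ, conjDiag U d ^ k = conjDiag U (fun i => d i ^ k) := by
      intro k
      induction k with
      | zero => simpa using hC 1
      | succ k ih => rw [pow_succ, ih, hmul]; rfl
    rw [this, hmul]
    simp [Polynomial.eval_monomial]

/-- For `x` outside the range of `d`, a polynomial interpolating `(x - y)⁻¹` at the values of `d`
provides a two-sided inverse of `x - conjDiag U d`. -/
theorem spectrum_conjDiag (U : Matrix.unitaryGroup n ℂ) (d : n → ℝ) :
    spectrum ℝ (conjDiag U d) ⊆ Set.range d := by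
  intro x hx
  by_contra hx'
  have hne : ∀ i, d i - x ≠ 0 := fun i hi => hx' ⟨i, by linarith⟩
  obtain ⟨q, hq⟩ := exists_polynomial_eval_eq (fun y => (x - y)⁻¹) (Finset.univ.image d)
  have hq' : ∀ i, q.eval (d i) = (x - d i)⁻¹ := fun i =>
    hq _ (Finset.mem_image_of_mem _ (Finset.mem_univ i))
  have e1 : Polynomial.aeval (conjDiag U d) ((Polynomial.C x - Polynomial.X) * q) = 1 := by
    rw [show (1 : Matrix n n ℂ) = Polynomial.aeval (conjDiag U d) (1 : Polynomial ℝ) by simp,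
      aeval_conjDiag, aeval_conjDiag]
    congr 1
    funext i
    have : x - d i ≠ 0 := fun h => hne i (by linarith)
    simp [hq', this]
  have e2 : Polynomial.aeval (conjDiag U d) (q * (Polynomial.C x - Polynomial.X)) = 1 := by
    rw [mul_comm]; exact e1
  rw [map_mul] at e1 e2
  have e3 : Polynomial.aeval (conjDiag U d) (Polynomial.C x - Polynomial.X)
      = algebraMap ℝ _ x - conjDiag U d := by simp
  rw [e3] at e1 e2
  exact hx ⟨⟨_, _, e1, e2⟩, rfl⟩

theorem cfc_conjDiag (f : ℝ → ℝ) (U : Matrix.unitaryGroup n ℂ) (d : n → ℝ) :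
    cfc f (conjDiag U d) = conjDiag U (fun i => f (d i)) := by
  obtain ⟨q, hq⟩ := exists_polynomial_eval_eq f (Finset.univ.image d)
  have hq' : ∀ i, q.eval (d i) = f (d i) := fun i =>
    hq _ (Finset.mem_image_of_mem _ (Finset.mem_univ i))
  have : cfc f (conjDiag U d) = cfc (fun x => q.eval x) (conjDiag U d) := by
    refine cfc_congr fun x hx => ?_
    obtain ⟨i, rfl⟩ := spectrum_conjDiag U d hx
    exact (hq' i).symm
  rw [this, cfc_polynomial q _ (isHermitian_conjDiag U d).isSelfAdjoint, aeval_conjDiag]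
  simp only [hq']

theorem trace_mul_cfc_conjDiag (A : Matrix n n ℂ) (f : ℝ → ℝ) (U : Matrix.unitaryGroup n ℂ)
    (d : n → ℝ) : (A * cfc f (conjDiag U d)).trace.re = ∑ i, weight U A i * f (d i) := by
  rw [cfc_conjDiag, trace_mul_conjDiag]

theorem crossLog_conjDiag (A : Matrix n n ℂ) (U : Matrix.unitaryGroup n ℂ) (d : n → ℝ) :
    crossLog A (conjDiag U d) = ∑ i, weight U A i * Real.log (d i) :=
  trace_mul_cfc_conjDiag A Real.log U d

theorem supp_le_supp_iff (A B : Matrix n n ℂ) :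
    supp A ≤ supp B ↔ ∀ v : n → ℂ, B *ᵥ v = 0 → A *ᵥ v = 0 := by
  rw [supp, supp, Submodule.orthogonal_le_orthogonal_iff]
  constructor
  · intro h v hv
    have hB : WithLp.toLp 2 v ∈ LinearMap.ker (Matrix.toEuclideanLin B) :=
      LinearMap.mem_ker.2 (congrArg (WithLp.toLp 2) hv)
    exact congrArg WithLp.ofLp (LinearMap.mem_ker.1 (h hB))
  · intro h v hv
    have hv' : B *ᵥ v.ofLp = 0 := congrArg WithLp.ofLp (LinearMap.mem_ker.1 hv)
    exact LinearMap.mem_ker.2 (congrArg (WithLp.toLp 2) (h _ hv'))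

/-- A positive semidefinite matrix with a zero diagonal entry has a zero column there, so support
inclusion can be read off the diagonal weights. -/
theorem supp_le_supp_conjDiag_iff {A : Matrix n n ℂ} (hA : A.PosSemidef)
    (U : Matrix.unitaryGroup n ℂ) (d : n → ℝ) :
    supp A ≤ supp (conjDiag U d) ↔ ∀ i, d i = 0 → weight U A i = 0 := by
  have h : star (U : Matrix n n ℂ) * (U : Matrix n n ℂ) = 1 := Unitary.star_mul_self_of_mem U.2
  have h' : (U : Matrix n n ℂ) * star (U : Matrix n n ℂ) = 1 := Unitary.mul_star_self_of_mem U.2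
  have hAU := hA.conjTranspose_mul_mul_same (U : Matrix n n ℂ)
  rw [← Matrix.star_eq_conjTranspose] at hAU
  rw [supp_le_supp_iff]
  constructor
  · intro hs i hi
    have e : conjDiag U d *ᵥ ((U : Matrix n n ℂ) *ᵥ Pi.single i 1) = 0 := by
      rw [Matrix.mulVec_mulVec, conjDiag, Matrix.mul_assoc, h, Matrix.mul_one,
        ← Matrix.mulVec_mulVec, Matrix.diagonal_mulVec_single, hi]
      simp
    have e2 := hs _ e
    have e3 : (star (U : Matrix n n ℂ) * A * (U : Matrix n n ℂ)) *ᵥ Pi.single i 1 = 0 := by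
      rw [← Matrix.mulVec_mulVec, ← Matrix.mulVec_mulVec, e2, Matrix.mulVec_zero]
    have e4 := congrFun e3 i
    rw [Matrix.mulVec_single_one] at e4
    rw [weight]
    simpa using congrArg Complex.re e4
  · intro hs v hv
    set w := star (U : Matrix n n ℂ) *ᵥ v with hw
    have hvw : v = (U : Matrix n n ℂ) *ᵥ w := by
      rw [hw, Matrix.mulVec_mulVec, h', Matrix.one_mulVec]
    have hD : Matrix.diagonal (fun i => (d i : ℂ)) *ᵥ w = 0 := by
      have := congrArg (fun z => star (U : Matrix n n ℂ) *ᵥ z) hv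
      simp only [Matrix.mulVec_zero] at this
      rw [hvw, Matrix.mulVec_mulVec, Matrix.mulVec_mulVec, star_mul_conjDiag_mul] at this
      exact this
    set C := star (U : Matrix n n ℂ) * A * (U : Matrix n n ℂ) with hC
    have hcol : ∀ i, d i = 0 → C *ᵥ Pi.single i 1 = 0 := by
      intro i hi
      rw [← hAU.dotProduct_mulVec_zero_iff]
      have hre : (C i i).re = 0 := hs i hi
      have him : (C i i).im = 0 := ((Complex.le_def.1 (hAU.diag_nonneg (i := i))).2).symm
      have : C i i = 0 := Complex.ext hre him
      simpa using this
    have hCw : C *ᵥ w = 0 := by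
      have : w = ∑ i, w i • (Pi.single i 1 : n → ℂ) := by
        ext j
        simp [Finset.sum_apply, Pi.single_apply]
      rw [this, Matrix.mulVec_sum]
      refine Finset.sum_eq_zero fun i _ => ?_
      rw [Matrix.mulVec_smul]
      by_cases hi : d i = 0
      · rw [hcol i hi, smul_zero]
      · have := congrFun hD i
        rw [Matrix.mulVec_diagonal] at this
        have hwi : w i = 0 := by simpa [hi] using this
        rw [hwi, zero_smul]
    have : A *ᵥ v = (U : Matrix n n ℂ) *ᵥ (C *ᵥ w) := by
      rw [Matrix.mulVec_mulVec, hC, hw, Matrix.mulVec_mulVec]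
      congr 1
      calc A = (U * star (U : Matrix n n ℂ)) * A * (U * star (U : Matrix n n ℂ)) := by
            rw [h', Matrix.one_mul, Matrix.mul_one]
        _ = _ := by simp only [Matrix.mul_assoc]
    rw [this, hCw, Matrix.mulVec_zero]

/-- **Klein's inequality**: nonnegativity of relative entropy. -/
theorem crossLog_le_crossLog_self {A B : Matrix n n ℂ} (hA : A.PosSemidef) (hB : B.PosSemidef)
    (htr : A.trace = B.trace) (hs : supp A ≤ supp B) : crossLog A B ≤ crossLog A A := by
  obtain ⟨U, d, rfl⟩ := exists_eq_conjDiag hB.1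
  obtain ⟨W, p, rfl⟩ := exists_eq_conjDiag hA.1
  rw [supp_le_supp_conjDiag_iff hA] at hs
  have hd := conjDiag_nonneg hB
  have hp := conjDiag_nonneg hA
  set M : n → n → ℝ := fun i k =>
    Complex.normSq ((star (U : Matrix n n ℂ) * (W : Matrix n n ℂ)) i k) with hM
  have hM0 : ∀ i k, 0 ≤ M i k := fun i k => Complex.normSq_nonneg _
  have hrow : ∀ i, ∑ k, M i k = 1 := fun i => sum_normSq_unitary_row (star U * W) i
  have hcol : ∀ k, ∑ i, M i k = 1 := fun k => sum_normSq_unitary_col (star U * W) k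
  have hw : ∀ i, weight U (conjDiag W p) i = ∑ k, M i k * p k := weight_conjDiag U W p
  have hzero : ∀ i k, d i = 0 → M i k * p k = 0 := by
    intro i k hi
    have h1 := hs i hi
    rw [hw] at h1
    exact (Finset.sum_eq_zero_iff_of_nonneg
      (fun k _ => mul_nonneg (hM0 i k) (hp k))).1 h1 k (Finset.mem_univ k)
  -- The scalar inequality $x-y\le x\ln x-x\ln y$, weighted by `M`. Where `d i = 0`, the support
  -- condition makes either `M i k` or `p k` vanish.
  have hterm : ∀ i k, M i k * (p k - d i)
      ≤ M i k * (p k * Real.log (p k)) - M i k * p k * Real.log (d i) := by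
    intro i k
    rcases (hp k).eq_or_lt with hk | hk
    · rw [← hk]
      have := mul_nonneg (hM0 i k) (hd i)
      simp only [zero_mul, mul_zero, sub_zero, zero_sub]
      linarith
    rcases (hd i).eq_or_lt with hi | hi
    · have h0 : M i k = 0 := by
        rcases mul_eq_zero.1 (hzero i k hi.symm) with h | h
        · exact h
        · exact absurd h hk.ne'
      simp [h0]
    · have h1 : p k - d i ≤ p k * Real.log (p k) - p k * Real.log (d i) := by
        have h2 := Real.log_le_sub_one_of_pos (div_pos hi hk)
        rw [Real.log_div hi.ne' hk.ne'] at h2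
        have h3 := mul_le_mul_of_nonneg_left h2 hk.le
        have h4 : p k * (d i / p k - 1) = d i - p k := by field_simp
        rw [h4] at h3
        linarith
      have h5 := mul_le_mul_of_nonneg_left h1 (hM0 i k)
      linarith
  have hsum : ∑ k, p k = ∑ i, d i := by
    have h1 := congrArg Complex.re htr
    rw [← sum_weight U (conjDiag U d), ← sum_weight W (conjDiag W p)] at h1
    simpa only [weight_self] using h1
  have hAA : crossLog (conjDiag W p) (conjDiag W p)
      = ∑ i, ∑ k, M i k * (p k * Real.log (p k)) := by
    rw [crossLog_conjDiag, Finset.sum_comm]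
    refine Finset.sum_congr rfl fun k _ => ?_
    rw [weight_self, ← Finset.sum_mul, hcol, one_mul]
  have hAB : crossLog (conjDiag W p) (conjDiag U d)
      = ∑ i, ∑ k, M i k * p k * Real.log (d i) := by
    rw [crossLog_conjDiag]
    refine Finset.sum_congr rfl fun i _ => ?_
    rw [hw, Finset.sum_mul]
  have hdiff : ∑ i, ∑ k, M i k * (p k - d i) = 0 := by
    simp only [mul_sub, Finset.sum_sub_distrib]
    rw [Finset.sum_comm]
    simp only [← Finset.sum_mul, hrow, hcol, one_mul, hsum, sub_self]
  have hfin : ∑ i, ∑ k, M i k * (p k - d i)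
      ≤ ∑ i, ∑ k, (M i k * (p k * Real.log (p k)) - M i k * p k * Real.log (d i)) :=
    Finset.sum_le_sum fun i _ => Finset.sum_le_sum fun k _ => hterm i k
  rw [hdiff] at hfin
  simp only [Finset.sum_sub_distrib] at hfin
  rw [hAA, hAB]
  linarith

end

/-! ### Compactness of the state space and continuity of the entropy. -/

section

variable {n m : Type*} [Fintype n] [DecidableEq n] [Fintype m] [DecidableEq m]

theorem norm_conjDiag_apply_le {U : Matrix.unitaryGroup n ℂ} {d : n → ℝ} (hd : ∀ i, 0 ≤ d i)
    (i j : n) : ‖conjDiag U d i j‖ ≤ ∑ k, d k := by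
  rw [conjDiag, Matrix.mul_apply]
  refine (norm_sum_le _ _).trans (Finset.sum_le_sum fun k _ => ?_)
  rw [Matrix.mul_diagonal, Matrix.star_apply, norm_mul, norm_mul, norm_star,
    Complex.norm_of_nonneg (hd k)]
  have h1 := entry_norm_bound_of_unitary U.2 i k
  have h2 := entry_norm_bound_of_unitary U.2 j k
  calc _ ≤ 1 * d k * 1 := by gcongr <;> simpa using hd k
    _ = d k := by rw [one_mul, mul_one]

theorem sum_eigenvalues_eq_one {U : Matrix.unitaryGroup n ℂ} {d : n → ℝ}
    (h : (conjDiag U d).trace = 1) : ∑ k, d k = 1 := by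
  have := sum_weight U (conjDiag U d)
  simp only [weight_self, h, Complex.one_re] at this
  exact this

theorem isClosed_state :
    IsClosed {ρ : Matrix n n ℂ | ρ.PosSemidef ∧ ρ.trace = 1} := by
  have h : {ρ : Matrix n n ℂ | ρ.PosSemidef ∧ ρ.trace = 1}
      = ({ρ | ρᴴ = ρ} ∩ ⋂ x : n → ℂ, {ρ | 0 ≤ star x ⬝ᵥ (ρ *ᵥ x)}) ∩ {ρ | ρ.trace = 1} := by
    ext ρ
    simp only [Set.mem_ofPred_eq, Set.mem_inter_iff, Set.mem_iInter,
      Matrix.posSemidef_iff_dotProduct_mulVec, Matrix.IsHermitian]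
  rw [h]
  refine ((isClosed_eq (by fun_prop) (by fun_prop)).inter (isClosed_iInter fun x => ?_)).inter
    (isClosed_eq (by fun_prop) (by fun_prop))
  refine isClosed_le continuous_const ?_
  fun_prop

instance compactSpace_state : CompactSpace (State n) := by
  refine isCompact_iff_compactSpace.1 (IsCompact.of_isClosed_subset
    (s := Set.pi Set.univ fun _ => Set.pi Set.univ fun _ => Metric.closedBall (0 : ℂ) 1)
    ?_ isClosed_state ?_)
  · exact isCompact_univ_pi fun _ => isCompact_univ_pi fun _ => isCompact_closedBall _ _
  · rintro ρ ⟨hρ, htr⟩ i - j -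
    obtain ⟨U, d, rfl⟩ := exists_eq_conjDiag hρ.1
    rw [mem_closedBall_zero_iff, ← sum_eigenvalues_eq_one htr]
    exact norm_conjDiag_apply_le (conjDiag_nonneg hρ) i j

instance nonempty_state [Nonempty n] : Nonempty (State n) := by
  obtain ⟨i⟩ := ‹Nonempty n›
  refine ⟨⟨Matrix.diagonal (Pi.single i 1), Matrix.PosSemidef.diagonal ?_, ?_⟩⟩
  · exact Pi.single_nonneg.2 zero_le_one
  · simp [Matrix.trace_diagonal]

theorem spectrum_state_subset (ρ : State n) : spectrum ℝ ρ.1 ⊆ Set.Icc 0 1 := by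
  obtain ⟨ρ, hρ, htr⟩ := ρ
  obtain ⟨U, d, rfl⟩ := exists_eq_conjDiag hρ.1
  intro x hx
  obtain ⟨i, rfl⟩ := spectrum_conjDiag U d hx
  refine ⟨conjDiag_nonneg hρ i, ?_⟩
  rw [← sum_eigenvalues_eq_one htr]
  exact Finset.single_le_sum (fun k _ => conjDiag_nonneg hρ k) (Finset.mem_univ i)

section

open scoped Matrix.Norms.L2Operator

theorem continuousOn_cfc_matrix {s : Set ℝ} (hs : IsCompact s) (f : ℝ → ℝ)
    (hf : ContinuousOn f s) :
    ContinuousOn (fun A : Matrix n n ℂ => cfc f A) {A | IsSelfAdjoint A ∧ spectrum ℝ A ⊆ s} := by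
  have := continuousOn_cfc (Matrix n n ℂ) hs f hf
  convert this

end

theorem continuous_cfc_state {f : ℝ → ℝ} (hf : Continuous f) :
    Continuous fun ρ : State n => cfc f ρ.1 :=
  (continuousOn_cfc_matrix isCompact_Icc f hf.continuousOn).comp_continuous
    continuous_subtype_val fun ρ => ⟨ρ.2.1.1.isSelfAdjoint, spectrum_state_subset ρ⟩

theorem entropy_eq_neg_crossLog (ρ : State n) : entropy ρ = -crossLog ρ.1 ρ.1 := rfl

/-- Continuity of the entropy needs this form: `Real.negMulLog` is continuous on the whole line,
`Real.log` is not. -/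
theorem entropy_eq_trace_cfc (ρ : State n) :
    entropy ρ = (cfc Real.negMulLog ρ.1).trace.re := by
  obtain ⟨ρ, hρ, htr⟩ := ρ
  obtain ⟨U, d, rfl⟩ := exists_eq_conjDiag hρ.1
  rw [entropy_eq_neg_crossLog, crossLog_conjDiag, cfc_conjDiag, ← sum_weight U,
    ← Finset.sum_neg_distrib]
  refine Finset.sum_congr rfl fun i _ => ?_
  rw [weight_self, weight_self, Real.negMulLog, neg_mul]

theorem continuous_entropy : Continuous (entropy : State n → ℝ) := by
  have h : (entropy : State n → ℝ) = fun ρ => (cfc Real.negMulLog ρ.1).trace.re :=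
    funext entropy_eq_trace_cfc
  rw [h]
  exact Complex.continuous_re.comp
    (continuous_cfc_state Real.continuous_negMulLog).matrix_trace

/-! ### Upper semicontinuity of `crossLog` in its second argument. -/

/-- The logarithm shifted by `ε`, made continuous on the whole line. -/
noncomputable def shiftedLog (ε x : ℝ) : ℝ := Real.log (max x 0 + ε)

theorem continuous_shiftedLog {ε : ℝ} (hε : 0 < ε) : Continuous (shiftedLog ε) := by
  refine Continuous.log (by fun_prop) fun x => ?_
  have := le_max_right x 0
  linarith

/-- The support hypothesis is essential: at a zero eigenvalue `Real.log 0 = 0` would exceed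
`Real.log ε` for small `ε`, but the weight there vanishes. -/
theorem crossLog_le_trace_mul_cfc_shiftedLog {A B : Matrix n n ℂ} (hA : A.PosSemidef)
    (hB : B.PosSemidef) (hs : supp A ≤ supp B) {ε : ℝ} (hε : 0 < ε) :
    crossLog A B ≤ (A * cfc (shiftedLog ε) B).trace.re := by
  obtain ⟨U, d, rfl⟩ := exists_eq_conjDiag hB.1
  rw [supp_le_supp_conjDiag_iff hA] at hs
  rw [crossLog_conjDiag, trace_mul_cfc_conjDiag]
  refine Finset.sum_le_sum fun i _ => ?_
  rcases (conjDiag_nonneg hB i).eq_or_lt with h | h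
  · simp [hs i h.symm]
  · refine mul_le_mul_of_nonneg_left ?_ (weight_nonneg hA U i)
    rw [shiftedLog, max_eq_left h.le]
    exact Real.log_le_log h (by linarith)

/-- Positive weight on the kernel of `B` would send the right side of `hc` to $-\infty$ as `ε → 0`.
With the supports nested, the limit is `crossLog A B`. -/
theorem supp_le_and_le_crossLog {A B : Matrix n n ℂ} (hA : A.PosSemidef) (hB : B.PosSemidef)
    {c : ℝ} (hc : ∀ ε > 0, c ≤ (A * cfc (shiftedLog ε) B).trace.re) :
    supp A ≤ supp B ∧ c ≤ crossLog A B := by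
  obtain ⟨U, d, rfl⟩ := exists_eq_conjDiag hB.1
  have hd := conjDiag_nonneg hB
  have hw := weight_nonneg hA U
  simp only [trace_mul_cfc_conjDiag, shiftedLog, max_eq_left (hd _)] at hc
  have hs : ∀ i, d i = 0 → weight U A i = 0 := by
    intro j hj
    by_contra hne
    have hpos : 0 < weight U A j := (hw j).lt_of_ne' hne
    set K := ∑ i, weight U A i * Real.log (d i + 1) with hK
    -- Chosen so that the term at `j` equals `-(|K| + |c| + 1)`. Since `ε ≤ 1`, the other terms add
    -- up to at most `K`, so the total falls below `c`.
    set ε := Real.exp (-(|K| + |c| + 1) / weight U A j) with hε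
    have hε1 : ε ≤ 1 := by
      rw [hε, Real.exp_le_one_iff]
      exact div_nonpos_of_nonpos_of_nonneg
        (by have := abs_nonneg K; have := abs_nonneg c; linarith) hpos.le
    have h1 := hc ε (Real.exp_pos _)
    have h2 : ∑ i, weight U A i * Real.log (d i + ε)
        ≤ ∑ i, (weight U A i * Real.log (d i + 1)
          + if i = j then weight U A j * Real.log ε else 0) := by
      refine Finset.sum_le_sum fun i _ => ?_
      split_ifs with h
      · subst h
        simp [hj]
      · rw [add_zero]
        refine mul_le_mul_of_nonneg_left (Real.log_le_log ?_ (by linarith)) (hw i)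
        have := hd i
        have := Real.exp_pos (-(|K| + |c| + 1) / weight U A j)
        linarith
    rw [Finset.sum_add_distrib, Finset.sum_ite_eq' Finset.univ j, if_pos (Finset.mem_univ j),
      ← hK, hε, Real.log_exp, mul_div_cancel₀ _ hne] at h2
    have := le_abs_self K
    have := neg_abs_le c
    linarith
  refine ⟨(supp_le_supp_conjDiag_iff hA U d).2 hs, ?_⟩
  rw [crossLog_conjDiag]
  have hlim : Tendsto (fun ε => ∑ i, weight U A i * Real.log (d i + ε)) (𝓝[>] 0)
      (𝓝 (∑ i, weight U A i * Real.log (d i))) := by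
    refine tendsto_finsetSum _ fun i _ => ?_
    by_cases hi : d i = 0
    · simp [hs i hi]
    · refine Tendsto.const_mul _ (Tendsto.log ?_ hi)
      have : Tendsto (fun ε : ℝ => d i + ε) (𝓝 0) (𝓝 (d i + 0)) :=
        (continuous_const.add continuous_id).tendsto 0
      rw [add_zero] at this
      exact this.mono_left nhdsWithin_le_nhds
  exact ge_of_tendsto hlim (eventually_nhdsWithin_of_forall fun ε hε => hc ε hε)

/-! ### Mixtures of states and their supports. -/

/-- The convex mixture `(1 - t) φ + t ρ` of two states. -/
def mix (φ ρ : State n) (t : ℝ) (ht : 0 ≤ t ∧ t ≤ 1) : State n :=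
  ⟨((1 - t : ℝ) : ℂ) • φ.1 + (t : ℂ) • ρ.1,
    (φ.2.1.smul (by exact_mod_cast sub_nonneg.2 ht.2)).add
      (ρ.2.1.smul (by exact_mod_cast ht.1)), by
    rw [Matrix.trace_add, Matrix.trace_smul, Matrix.trace_smul, φ.2.2, ρ.2.2]
    simp⟩

theorem app_mix (Φ : Channel n m) (φ ρ : State n) (t : ℝ) (ht : 0 ≤ t ∧ t ≤ 1) :
    Φ.app (mix φ ρ t ht) = mix (Φ.app φ) (Φ.app ρ) t ht :=
  Subtype.ext (by simp [Channel.app, mix])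

theorem crossLog_mix (φ ρ : State n) (t : ℝ) (ht : 0 ≤ t ∧ t ≤ 1) (B : Matrix n n ℂ) :
    crossLog (mix φ ρ t ht).1 B = (1 - t) * crossLog φ.1 B + t * crossLog ρ.1 B := by
  simp [crossLog, mix, Matrix.add_mul, Matrix.trace_add, -Complex.ofReal_sub]

theorem mulVec_eq_zero_of_add {A B : Matrix n n ℂ} (hA : A.PosSemidef) (hB : B.PosSemidef)
    {v : n → ℂ} (h : (A + B) *ᵥ v = 0) : A *ᵥ v = 0 ∧ B *ᵥ v = 0 := by
  have h0 : star v ⬝ᵥ (A *ᵥ v) + star v ⬝ᵥ (B *ᵥ v) = 0 := by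
    rw [← dotProduct_add, ← Matrix.add_mulVec, h, dotProduct_zero]
  have h1 := hA.dotProduct_mulVec_nonneg v
  have h2 := hB.dotProduct_mulVec_nonneg v
  rw [← hA.dotProduct_mulVec_zero_iff, ← hB.dotProduct_mulVec_zero_iff]
  exact (add_eq_zero_iff_of_nonneg h1 h2).1 h0

/-- The kernel of a sum of positive semidefinite matrices is the intersection of their kernels. -/
theorem supp_le_supp_mix (φ ρ : State n) (t : ℝ) (ht : 0 < t ∧ t < 1) :
    supp φ.1 ≤ supp (mix φ ρ t ⟨ht.1.le, ht.2.le⟩).1 ∧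
      supp ρ.1 ≤ supp (mix φ ρ t ⟨ht.1.le, ht.2.le⟩).1 := by
  rw [supp_le_supp_iff, supp_le_supp_iff, ← forall_and]
  intro v
  rw [← imp_and]
  intro hv
  have h1 : (((1 - t : ℝ) : ℂ) • φ.1).PosSemidef :=
    φ.2.1.smul (by exact_mod_cast sub_nonneg.2 ht.2.le)
  have h2 : ((t : ℂ) • ρ.1).PosSemidef := ρ.2.1.smul (by exact_mod_cast ht.1.le)
  obtain ⟨e1, e2⟩ := mulVec_eq_zero_of_add h1 h2 hv
  rw [Matrix.smul_mulVec, smul_eq_zero] at e1 e2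
  exact ⟨e1.resolve_left (by exact_mod_cast (sub_pos.2 ht.2).ne'),
    e2.resolve_left (by exact_mod_cast ht.1.ne')⟩

theorem supp_mix_le {φ ρ : State n} (h : supp ρ.1 ≤ supp φ.1) (t : ℝ) (ht : 0 ≤ t ∧ t ≤ 1) :
    supp (mix φ ρ t ht).1 ≤ supp φ.1 := by
  rw [supp_le_supp_iff] at h ⊢
  intro v hv
  rw [mix, Matrix.add_mulVec, Matrix.smul_mulVec, Matrix.smul_mulVec, hv, h v hv]
  simp

theorem relEnt_of_supp_le {A B : Matrix n n ℂ} (h : supp A ≤ supp B) :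
    relEnt A B = ((crossLog A A - crossLog A B : ℝ) : EReal) := by
  rw [relEnt, if_pos h, Matrix.mul_sub, Matrix.trace_sub, Complex.sub_re, crossLog, crossLog]

theorem supp_le_of_relEnt_ne_top {A B : Matrix n n ℂ} (h : relEnt A B ≠ ⊤) :
    supp A ≤ supp B := by
  by_contra h'
  exact h (by rw [relEnt, if_neg h'])

/-! ### The lower bound on entropy production from its minimizer. -/

/-- Entropy production for a real linear entropy flow. -/
noncomputable def realEP (Φ : Channel n m) (L : Matrix n n ℂ →ₗ[ℝ] ℝ) (ρ : State n) : ℝ :=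
  entropy (Φ.app ρ) - entropy ρ + L ρ.1

theorem map_mix (L : Matrix n n ℂ →ₗ[ℝ] ℝ) (φ ρ : State n) (t : ℝ) (ht : 0 ≤ t ∧ t ≤ 1) :
    L (mix φ ρ t ht).1 = (1 - t) * L φ.1 + t * L ρ.1 := by
  change L (((1 - t : ℝ) : ℂ) • φ.1 + (t : ℂ) • ρ.1) = _
  rw [Complex.coe_smul, Complex.coe_smul, map_add, map_smul, map_smul, smul_eq_mul, smul_eq_mul]

/-- The contraction of relative entropy towards a minimizer of the entropy production is a lower
bound on the entropy production. -/
theorem contraction_le_realEP {Φ : Channel n m} {L : Matrix n n ℂ →ₗ[ℝ] ℝ} {φ : State n}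
    (hmin : ∀ σ, realEP Φ L φ ≤ realEP Φ L σ) (h0 : ∀ σ, 0 ≤ realEP Φ L σ) (ρ : State n) :
    contraction Φ ρ φ ≤ (realEP Φ L ρ : EReal) := by
  rw [contraction]
  split_ifs with htop
  -- Here the contraction is `0` by convention, and the second law suffices.
  · exact_mod_cast h0 ρ
  have hs' := supp_le_of_relEnt_ne_top htop
  -- The desired inequality solved for `crossLog ρ.1 φ.1`.
  set c : ℝ := -entropy ρ - (realEP Φ L ρ - realEP Φ L φ)
    - (crossLog (Φ.app ρ).1 (Φ.app ρ).1 - crossLog (Φ.app ρ).1 (Φ.app φ).1) with hc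
  -- Minimality at the mixture, with Klein's inequality used twice: for the outputs against `Φ.app
  -- φ`, and for `φ` against the mixture. The terms in `φ` leave a common factor `t`.
  have key : ∀ t : ℝ, ∀ ht : 0 < t ∧ t < 1,
      c ≤ crossLog ρ.1 (mix φ ρ t ⟨ht.1.le, ht.2.le⟩).1 := by
    intro t ht
    have ht' : 0 ≤ t ∧ t ≤ 1 := ⟨ht.1.le, ht.2.le⟩
    have h1 := hmin (mix φ ρ t ht')
    have h2 := crossLog_le_crossLog_self (Φ.app (mix φ ρ t ht')).2.1 (Φ.app φ).2.1
      ((Φ.app (mix φ ρ t ht')).2.2.trans (Φ.app φ).2.2.symm)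
      (by rw [app_mix]; exact supp_mix_le hs' t ht')
    have h3 := crossLog_le_crossLog_self φ.2.1 (mix φ ρ t ht').2.1
      (φ.2.2.trans (mix φ ρ t ht').2.2.symm) (supp_le_supp_mix φ ρ t ht).1
    have h4 := crossLog_mix φ ρ t ht' (mix φ ρ t ht').1
    have h5 := crossLog_mix (Φ.app φ) (Φ.app ρ) t ht' (Φ.app φ).1
    rw [← app_mix] at h5
    rw [h5] at h2
    simp only [realEP, map_mix, entropy_eq_neg_crossLog] at h1 hc
    rw [h4] at h1
    have h6 := mul_le_mul_of_nonneg_left h3 (sub_nonneg.2 ht.2.le)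
    have h7 : t * c ≤ t * crossLog ρ.1 (mix φ ρ t ht').1 := by
      rw [hc]
      linarith
    exact le_of_mul_le_mul_left h7 ht.1
  -- For singular `φ`, `crossLog` against the mixture need not be continuous at `t = 0`. Its shifted
  -- upper bound is, so `t → 0` comes before `ε → 0`.
  have hlim : ∀ ε > 0, c ≤ (ρ.1 * cfc (shiftedLog ε) φ.1).trace.re := by
    intro ε hε
    have hcont : Continuous fun t : Set.Icc (0 : ℝ) 1 =>
        (ρ.1 * cfc (shiftedLog ε) (mix φ ρ t.1 t.2).1).trace.re := by
      have hm : Continuous fun t : Set.Icc (0 : ℝ) 1 => mix φ ρ t.1 t.2 := by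
        refine Continuous.subtype_mk ?_ _
        fun_prop
      exact Complex.continuous_re.comp (Continuous.matrix_trace
        (continuous_const.matrix_mul ((continuous_cfc_state (continuous_shiftedLog hε)).comp hm)))
    have hz : mix φ ρ 0 ⟨le_rfl, zero_le_one⟩ = φ := Subtype.ext (by simp [mix])
    have hclosed : IsClosed {t : Set.Icc (0 : ℝ) 1 |
        c ≤ (ρ.1 * cfc (shiftedLog ε) (mix φ ρ t.1 t.2).1).trace.re} :=
      isClosed_le continuous_const hcont
    -- The offset `2` keeps `t` strictly below `1` also at `k = 0`.
    have hseq : Tendsto (fun k : ℕ => (⟨1 / ((k : ℝ) + 2), by positivity, by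
        rw [div_le_one (by positivity)]; have := k.cast_nonneg (α := ℝ); linarith⟩ :
          Set.Icc (0 : ℝ) 1)) atTop (𝓝 ⟨0, le_rfl, zero_le_one⟩) := by
      rw [tendsto_subtype_rng]
      refine Tendsto.div_atTop tendsto_const_nhds ?_
      exact tendsto_atTop_add_const_right _ _ tendsto_natCast_atTop_atTop
    have := hclosed.mem_of_tendsto hseq (Eventually.of_forall fun k => by
      have hk : 0 < 1 / ((k : ℝ) + 2) ∧ 1 / ((k : ℝ) + 2) < 1 := by
        refine ⟨by positivity, ?_⟩
        rw [div_lt_one (by positivity)]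
        have := k.cast_nonneg (α := ℝ)
        linarith
      exact (key _ hk).trans (crossLog_le_trace_mul_cfc_shiftedLog ρ.2.1 (mix φ ρ _ _).2.1
        (supp_le_supp_mix φ ρ _ hk).2 hε))
    simpa only [Set.mem_ofPred_eq, hz] using this
  -- Minimality thus forces `supp ρ.1 ≤ supp φ.1`, which excludes an infinite contraction.
  obtain ⟨hs, hle⟩ := supp_le_and_le_crossLog ρ.2.1 φ.2.1 hlim
  rw [relEnt_of_supp_le hs, relEnt_of_supp_le hs', ← EReal.coe_sub, EReal.coe_le_coe_iff]
  have := h0 φ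
  rw [hc, entropy_eq_neg_crossLog] at hle
  linarith

theorem exists_logIrr_le_realEP [Nonempty n] (Φ : Channel n m) (L : Matrix n n ℂ →ₗ[ℝ] ℝ)
    (h0 : ∀ ρ, 0 ≤ realEP Φ L ρ) : ∃ ρ, logIrr Φ ≤ (realEP Φ L ρ : EReal) := by
  have hL : Continuous L := L.continuous_of_finiteDimensional
  have hΦ : Continuous Φ.toLin := Φ.toLin.continuous_of_finiteDimensional
  have happ : Continuous Φ.app := Continuous.subtype_mk (hΦ.comp continuous_subtype_val) _
  have hcont : Continuous (realEP Φ L) :=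
    ((continuous_entropy.comp happ).sub continuous_entropy).add (hL.comp continuous_subtype_val)
  obtain ⟨φ, -, hφ⟩ := isCompact_univ.exists_isMinOn (Set.univ_nonempty (α := State n))
    hcont.continuousOn
  obtain ⟨ρ, -, hρ⟩ := isCompact_univ.exists_isMaxOn (Set.univ_nonempty (α := State n))
    hcont.continuousOn
  refine ⟨ρ, (iInf_le _ φ).trans (iSup_le fun σ => ?_)⟩
  exact (contraction_le_realEP (fun τ => hφ (Set.mem_univ τ)) h0 σ).trans
    (EReal.coe_le_coe_iff.2 (hρ (Set.mem_univ σ)))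

/-! ### From affine functionals on states to linear functionals on matrices. -/

/-- An affine real functional on states extends to a real linear functional on matrices. -/
theorem exists_linear_extension (q : State n → ℝ)
    (hq : ∀ (φ ρ : State n) (t : ℝ) (ht : 0 < t ∧ t < 1),
      q (mix φ ρ t ⟨ht.1.le, ht.2.le⟩) = (1 - t) * q φ + t * q ρ) :
    ∃ L : Matrix n n ℂ →ₗ[ℝ] ℝ, ∀ ρ : State n, L ρ.1 = q ρ := by
  set G : Set (Matrix n n ℂ × ℝ) := Set.range fun ρ : State n => (ρ.1, q ρ) with hG
  have hcone : ∀ (a b : ℝ) (φ ρ : State n), 0 ≤ a → 0 ≤ b →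
      ∃ σ : State n, a • (φ.1, q φ) + b • (ρ.1, q ρ) = (a + b) • (σ.1, q σ) := by
    intro a b φ ρ ha hb
    rcases ha.eq_or_lt with rfl | ha
    · exact ⟨ρ, by simp⟩
    rcases hb.eq_or_lt with rfl | hb
    · exact ⟨φ, by simp⟩
    have hab : 0 < a + b := by linarith
    have ht : 0 < b / (a + b) ∧ b / (a + b) < 1 :=
      ⟨by positivity, (div_lt_one hab).2 (by linarith)⟩
    refine ⟨mix φ ρ _ ⟨ht.1.le, ht.2.le⟩, ?_⟩
    have e1 : (a + b) * (1 - b / (a + b)) = a := by field_simp; ring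
    have e2 : (a + b) * (b / (a + b)) = b := by field_simp
    refine Prod.ext ?_ ?_
    · change a • φ.1 + b • ρ.1 = (a + b) • (((1 - b / (a + b) : ℝ) : ℂ) • φ.1
        + ((b / (a + b) : ℝ) : ℂ) • ρ.1)
      rw [Complex.coe_smul, Complex.coe_smul, smul_add, smul_smul, smul_smul, e1, e2]
    · change a * q φ + b * q ρ = (a + b) * q _
      rw [hq _ _ _ ht, mul_add, ← mul_assoc, ← mul_assoc, e1, e2]
  -- By `hcone`, the positive and the negative terms of a combination each collapse to a multiple of
  -- one point of `G`. The case `x = 0` is separate because `State n` may be empty.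
  have hspan : ∀ x ∈ Submodule.span ℝ G, x = 0 ∨ ∃ (a b : ℝ) (φ ρ : State n), 0 ≤ a ∧ 0 ≤ b ∧
      x = a • (φ.1, q φ) - b • (ρ.1, q ρ) := by
    intro x hx
    induction hx using Submodule.span_induction with
    | mem x hx =>
      obtain ⟨ρ, rfl⟩ := hx
      exact Or.inr ⟨1, 0, ρ, ρ, zero_le_one, le_rfl, by simp⟩
    | zero => exact Or.inl rfl
    | add x y _ _ hx hy =>
      rcases hx with rfl | ⟨a, b, φ, ρ, ha, hb, rfl⟩
      · simpa using hy
      rcases hy with rfl | ⟨a', b', φ', ρ', ha', hb', rfl⟩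
      · exact Or.inr ⟨a, b, φ, ρ, ha, hb, by simp⟩
      obtain ⟨σ, hσ⟩ := hcone a a' φ φ' ha ha'
      obtain ⟨τ, hτ⟩ := hcone b b' ρ ρ' hb hb'
      refine Or.inr ⟨a + a', b + b', σ, τ, by linarith, by linarith, ?_⟩
      rw [← hσ, ← hτ]
      abel
    | smul c x _ hx =>
      rcases hx with rfl | ⟨a, b, φ, ρ, ha, hb, rfl⟩
      · exact Or.inl (smul_zero c)
      rcases le_total 0 c with hc | hc
      · exact Or.inr ⟨c * a, c * b, φ, ρ, by positivity, by positivity, by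
          rw [smul_sub, smul_smul, smul_smul]⟩
      · refine Or.inr ⟨-c * b, -c * a, ρ, φ, mul_nonneg (by linarith) hb,
          mul_nonneg (by linarith) ha, ?_⟩
        rw [smul_sub, smul_smul, smul_smul, neg_mul, neg_mul, neg_smul, neg_smul]
        abel
  -- The span is the graph of a function: states have trace one, so equal multiples of two states
  -- have equal coefficients, and then equal states unless the coefficient is zero.
  have hgraph : ∀ x ∈ Submodule.span ℝ G, x.1 = 0 → x.2 = 0 := by
    intro x hx h1
    rcases hspan x hx with rfl | ⟨a, b, φ, ρ, ha, hb, rfl⟩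
    · rfl
    have h2 : a • φ.1 = b • ρ.1 := sub_eq_zero.1 h1
    have h3 : a = b := by
      have := congrArg (fun M => (Matrix.trace M).re) h2
      simpa [Matrix.trace_smul, φ.2.2, ρ.2.2] using this
    subst h3
    change a * q φ - a * q ρ = 0
    by_cases h : a = 0
    · simp [h]
    · rw [Subtype.ext (smul_right_injective _ h h2), sub_self]
  set f := (Submodule.span ℝ G).toLinearPMap with hf
  obtain ⟨L, hL⟩ := LinearMap.exists_extend f.toFun
  refine ⟨L, fun ρ => ?_⟩
  have hmem : (ρ.1, q ρ) ∈ f.graph := by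
    rw [hf, Submodule.toLinearPMap_graph_eq _ hgraph]
    exact Submodule.subset_span ⟨ρ, rfl⟩
  rw [LinearPMap.mem_graph_iff] at hmem
  obtain ⟨y, hy1, hy2⟩ := hmem
  have := LinearMap.congr_fun hL y
  simp only at hy1 hy2
  rw [← hy2, ← hy1]
  exact this

theorem exists_logIrr_le_flowEP [Nonempty n] (Φ : Channel n m) (Q : State n → EReal)
    (linear : IsLinearFunctional Q) (second_law : ∀ ρ, 0 ≤ flowEP Φ Q ρ) :
    ∃ ρ, logIrr Φ ≤ flowEP Φ Q ρ := by
  by_cases htop : ∃ ρ, Q ρ = ⊤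
  · obtain ⟨ρ, hρ⟩ := htop
    exact ⟨ρ, by rw [flowEP, hρ, EReal.coe_add_top]; exact le_top⟩
  push Not at htop
  have hQ : ∀ ρ, ((Q ρ).toReal : EReal) = Q ρ := fun ρ =>
    EReal.coe_toReal (htop ρ) (linear.1 ρ)
  obtain ⟨L, hL⟩ := exists_linear_extension (fun ρ => (Q ρ).toReal) (by
    intro φ ρ t ht
    have := linear.2 ρ φ _ t ht.1 ht.2 (rfl : (mix φ ρ t ⟨ht.1.le, ht.2.le⟩).1 = _)
    rw [← hQ, ← hQ φ, ← hQ ρ] at this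
    exact_mod_cast this)
  have hEP : ∀ ρ, flowEP Φ Q ρ = (realEP Φ L ρ : EReal) := by
    intro ρ
    rw [flowEP, realEP, hL, EReal.coe_add, hQ]
  simp only [hEP] at second_law ⊢
  exact exists_logIrr_le_realEP Φ L fun ρ => by exact_mod_cast second_law ρ

end

/-! ### Dilations: relative entropy under isometries and tensor products. -/

section

variable {n m e : Type*} [Fintype n] [DecidableEq n] [Fintype m] [DecidableEq m]
  [Fintype e] [DecidableEq e]

theorem supp_isometry_le_iff {V : Matrix m n ℂ} (hV : Vᴴ * V = 1) (A B : Matrix n n ℂ) :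
    supp (V * A * Vᴴ) ≤ supp (V * B * Vᴴ) ↔ supp A ≤ supp B := by
  have hinj : ∀ (C : Matrix n n ℂ) (v : m → ℂ),
      (V * C * Vᴴ) *ᵥ v = 0 ↔ C *ᵥ (Vᴴ *ᵥ v) = 0 := by
    intro C v
    constructor
    · intro h
      have := congrArg (fun z => Vᴴ *ᵥ z) h
      simp only [Matrix.mulVec_mulVec, Matrix.mulVec_zero] at this ⊢
      rwa [← Matrix.mul_assoc, ← Matrix.mul_assoc, hV, Matrix.one_mul] at this
    · intro h
      rw [← Matrix.mulVec_mulVec, ← Matrix.mulVec_mulVec, h, Matrix.mulVec_zero]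
  simp only [supp_le_supp_iff, hinj]
  constructor
  · intro h v hv
    have := h (V *ᵥ v)
    rw [Matrix.mulVec_mulVec v Vᴴ V, hV, Matrix.one_mulVec] at this
    exact this hv
  · intro h v hv
    exact h _ hv

theorem aeval_mul_of_intertwine {V : Matrix m n ℂ} {J : Matrix m m ℂ} {A : Matrix n n ℂ}
    (h : J * V = V * A) (q : Polynomial ℝ) :
    Polynomial.aeval J q * V = V * Polynomial.aeval A q := by
  induction q using Polynomial.induction_on' with
  | add p r hp hr => rw [map_add, map_add, Matrix.add_mul, Matrix.mul_add, hp, hr]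
  | monomial k c =>
    have hpow : J ^ k * V = V * A ^ k := by
      induction k with
      | zero => simp
      | succ k ih => rw [pow_succ, Matrix.mul_assoc, h, ← Matrix.mul_assoc, ih, pow_succ,
          Matrix.mul_assoc]
    rw [Polynomial.aeval_monomial, Polynomial.aeval_monomial, ← Algebra.smul_def,
      ← Algebra.smul_def, Matrix.smul_mul, Matrix.mul_smul, hpow]

theorem matLog_eq_aeval {A : Matrix n n ℂ} (hA : A.IsHermitian) {q : Polynomial ℝ}
    (hq : ∀ x ∈ spectrum ℝ A, q.eval x = Real.log x) : matLog A = Polynomial.aeval A q := by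
  rw [← cfc_polynomial q A hA.isSelfAdjoint, matLog]
  exact cfc_congr fun x hx => (hq x hx).symm

/-- The spectra of `B` and `V * B * Vᴴ` may differ by `0`, so a single polynomial interpolates the
logarithm on both, and polynomials pass through the intertwiner `V`. -/
theorem crossLog_isometry {V : Matrix m n ℂ} (hV : Vᴴ * V = 1) (A : Matrix n n ℂ)
    {B : Matrix n n ℂ} (hB : B.IsHermitian) :
    crossLog (V * A * Vᴴ) (V * B * Vᴴ) = crossLog A B := by
  have hJ := Matrix.isHermitian_mul_mul_conjTranspose V hB
  obtain ⟨q, hq⟩ := exists_polynomial_eval_eq Real.log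
    ((Matrix.finite_real_spectrum (A := B)).toFinset
      ∪ (Matrix.finite_real_spectrum (A := V * B * Vᴴ)).toFinset)
  rw [crossLog, crossLog, matLog_eq_aeval hB fun x hx => hq x (by simp [hx]),
    matLog_eq_aeval hJ fun x hx => hq x (by simp [hx])]
  have hint : (V * B * Vᴴ) * V = V * B := by rw [Matrix.mul_assoc, hV, Matrix.mul_one]
  rw [Matrix.mul_assoc, Matrix.mul_assoc, Matrix.trace_mul_comm, Matrix.mul_assoc,
    Matrix.mul_assoc, aeval_mul_of_intertwine hint, ← Matrix.mul_assoc Vᴴ, hV, Matrix.one_mul]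

/-- The product of two orthonormal bases. -/
noncomputable def unitaryKronecker (U : Matrix.unitaryGroup n ℂ) (W : Matrix.unitaryGroup e ℂ) :
    Matrix.unitaryGroup (n × e) ℂ :=
  ⟨(U : Matrix n n ℂ) ⊗ₖ (W : Matrix e e ℂ), Matrix.kronecker_mem_unitary U.2 W.2⟩

theorem conjDiag_kronecker (U : Matrix.unitaryGroup n ℂ) (W : Matrix.unitaryGroup e ℂ)
    (a : n → ℝ) (b : e → ℝ) :
    conjDiag U a ⊗ₖ conjDiag W b = conjDiag (unitaryKronecker U W) fun p => a p.1 * b p.2 := by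
  rw [conjDiag, conjDiag, Matrix.mul_kronecker_mul, Matrix.mul_kronecker_mul,
    Matrix.diagonal_kronecker_diagonal, conjDiag, unitaryKronecker,
    Matrix.star_eq_conjTranspose, Matrix.star_eq_conjTranspose, Matrix.star_eq_conjTranspose,
    Matrix.conjTranspose_kronecker]
  simp

theorem conjDiag_one (U : Matrix.unitaryGroup n ℂ) : conjDiag U (fun _ => 1) = 1 := by
  simp [conjDiag]

/-- The rule $\ln(ab)=\ln a+\ln b$ fails for the convention $\ln 0=0$, but the support hypothesis
gives such eigenvectors weight zero. -/
theorem crossLog_kronecker {A : Matrix n n ℂ} {B : Matrix e e ℂ} {J : Matrix (n × e) (n × e) ℂ}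
    (hA : A.IsHermitian) (hB : B.IsHermitian) (hJ : J.PosSemidef) (hs : supp J ≤ supp (A ⊗ₖ B)) :
    crossLog J (A ⊗ₖ B)
      = (J * (matLog A ⊗ₖ (1 : Matrix e e ℂ))).trace.re
        + (J * ((1 : Matrix n n ℂ) ⊗ₖ matLog B)).trace.re := by
  obtain ⟨U, a, rfl⟩ := exists_eq_conjDiag hA
  obtain ⟨W, b, rfl⟩ := exists_eq_conjDiag hB
  rw [conjDiag_kronecker] at hs ⊢
  rw [supp_le_supp_conjDiag_iff hJ] at hs
  rw [matLog, matLog, cfc_conjDiag, cfc_conjDiag, ← conjDiag_one U, ← conjDiag_one W,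
    conjDiag_kronecker, conjDiag_kronecker, crossLog_conjDiag, trace_mul_conjDiag,
    trace_mul_conjDiag, ← Finset.sum_add_distrib]
  refine Finset.sum_congr rfl fun p _ => ?_
  by_cases h : a p.1 * b p.2 = 0
  · simp [hs p h]
  · rw [Real.log_mul (left_ne_zero_of_mul h) (right_ne_zero_of_mul h)]
    ring

theorem trace_mul_kronecker_one (J : Matrix (n × e) (n × e) ℂ) (X : Matrix n n ℂ) :
    (J * (X ⊗ₖ (1 : Matrix e e ℂ))).trace = (trEnv J * X).trace := by
  simp only [Matrix.trace, Matrix.diag_apply, Matrix.mul_apply, trEnv, Matrix.of_apply,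
    Fintype.sum_prod_type, Matrix.kroneckerMap_apply, Matrix.one_apply, mul_ite, mul_one,
    mul_zero, Finset.sum_ite_eq', Finset.mem_univ, if_true, Finset.sum_mul]
  refine Finset.sum_congr rfl fun i _ => ?_
  rw [Finset.sum_comm]

theorem crossLog_kronecker_self {A : Matrix n n ℂ} {B : Matrix e e ℂ}
    (hA : A.PosSemidef) (hB : B.PosSemidef) (hA1 : A.trace = 1) (hB1 : B.trace = 1) :
    crossLog (A ⊗ₖ B) (A ⊗ₖ B) = crossLog A A + crossLog B B := by
  rw [crossLog_kronecker hA.1 hB.1 (hA.kronecker hB) le_rfl, ← Matrix.mul_kronecker_mul,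
    ← Matrix.mul_kronecker_mul, Matrix.trace_kronecker, Matrix.trace_kronecker, Matrix.mul_one,
    Matrix.mul_one, hA1, hB1, mul_one, one_mul, crossLog, crossLog]

theorem jointState_mix (V : Matrix (m × e) (n × e) ℂ) (ω : State e) (φ ρ : State n) (t : ℝ)
    (ht : 0 ≤ t ∧ t ≤ 1) :
    jointState V ω (mix φ ρ t ht)
      = ((1 - t : ℝ) : ℂ) • jointState V ω φ + (t : ℂ) • jointState V ω ρ := by
  simp only [jointState, mix, Matrix.add_kronecker, Matrix.smul_kronecker, Matrix.mul_add,
    Matrix.add_mul, Matrix.mul_smul, Matrix.smul_mul]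

theorem posSemidef_jointState (V : Matrix (m × e) (n × e) ℂ) (ω : State e) (ρ : State n) :
    (jointState V ω ρ).PosSemidef :=
  (ρ.2.1.kronecker ω.2.1).mul_mul_conjTranspose_same V

theorem trace_jointState {V : Matrix (m × e) (n × e) ℂ} (hV : Vᴴ * V = 1) (ω : State e)
    (ρ : State n) : (jointState V ω ρ).trace = 1 := by
  rw [jointState, Matrix.mul_assoc, Matrix.trace_mul_comm, Matrix.mul_assoc, hV, Matrix.mul_one,
    Matrix.trace_kronecker, ρ.2.2, ω.2.2, one_mul]

theorem exists_logIrr_le_relEnt_jointState [Nonempty n] (Φ : Channel n m) (ω : State e)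
    (V : Matrix (m × e) (n × e) ℂ) (hV : Vᴴ * V = 1)
    (implements : ∀ ρ : State n, (Φ.app ρ).1 = trEnv (jointState V ω ρ)) :
    ∃ ρ, logIrr Φ ≤ relEnt (jointState V ω ρ) ((Φ.app ρ).1 ⊗ₖ ω.1) := by
  by_cases htop : ∃ ρ, relEnt (jointState V ω ρ) ((Φ.app ρ).1 ⊗ₖ ω.1) = ⊤
  · obtain ⟨ρ, hρ⟩ := htop
    exact ⟨ρ, hρ ▸ le_top⟩
  push Not at htop
  have hs := fun ρ => supp_le_of_relEnt_ne_top (htop ρ)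
  -- The entropy flow of the dilation,
  -- $\mathrm{tr}(\omega\ln\omega)-\mathrm{tr}\{J(1\otimes\ln\omega)\}$ with $J$ the joint final
  -- state: the isometry preserves the initial entropy $S(\rho)+S(\omega)$, and the system marginal
  -- of $J$ contributes $S(\Phi(\rho))$.
  set q : State n → ℝ := fun ρ => crossLog ω.1 ω.1
    - (jointState V ω ρ * ((1 : Matrix m m ℂ) ⊗ₖ matLog ω.1)).trace.re with hq
  obtain ⟨L, hL⟩ := exists_linear_extension q (by
    intro φ ρ t ht
    simp only [hq, jointState_mix, Matrix.add_mul, Matrix.smul_mul, Matrix.trace_add,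
      Matrix.trace_smul, smul_eq_mul, Complex.add_re, Complex.re_ofReal_mul]
    ring)
  have hEP : ∀ ρ, relEnt (jointState V ω ρ) ((Φ.app ρ).1 ⊗ₖ ω.1) = (realEP Φ L ρ : EReal) := by
    intro ρ
    rw [relEnt_of_supp_le (hs ρ), crossLog_kronecker (Φ.app ρ).2.1.1 ω.2.1.1
      (posSemidef_jointState V ω ρ) (hs ρ), trace_mul_kronecker_one, ← implements, realEP, hL, hq,
      jointState, crossLog_isometry hV _ (ρ.2.1.kronecker ω.2.1).1,
      crossLog_kronecker_self ρ.2.1 ω.2.1 ρ.2.2 ω.2.2, entropy_eq_neg_crossLog,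
      entropy_eq_neg_crossLog, ← crossLog]
    congr 1
    simp only [jointState]
    ring
  have h0 : ∀ ρ, 0 ≤ realEP Φ L ρ := by
    intro ρ
    rw [← EReal.coe_nonneg, ← hEP, relEnt_of_supp_le (hs ρ), EReal.coe_nonneg, sub_nonneg]
    refine crossLog_le_crossLog_self (posSemidef_jointState V ω ρ)
      ((Φ.app ρ).2.1.kronecker ω.2.1) ?_ (hs ρ)
    rw [trace_jointState hV, Matrix.trace_kronecker, (Φ.app ρ).2.2, ω.2.2, one_mul]
  simp only [hEP]
  exact exists_logIrr_le_realEP Φ L h0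

theorem exists_logIrr_le_ep [Nonempty n] (Φ : Channel n m) (P : PhysicalProcess Φ) :
    ∃ ρ, logIrr Φ ≤ P.ep ρ :=
  match P with
  | .flow Q linear second_law => exists_logIrr_le_flowEP Φ Q linear second_law
  | .dilation _ ω V isometry implements =>
    exists_logIrr_le_relEnt_jointState Φ ω V isometry implements

/-! ### Unitary channels and qubit reset. -/

theorem contraction_unitaryChannel (U : Matrix.unitaryGroup n ℂ) (ρ φ : State n) :
    contraction (unitaryChannel U) ρ φ = 0 := by
  have hU : (U : Matrix n n ℂ)ᴴ * (U : Matrix n n ℂ) = 1 := Unitary.star_mul_self_of_mem U.2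
  have happ : ∀ σ : State n,
      ((unitaryChannel U).app σ).1 = (U : Matrix n n ℂ) * σ.1 * (U : Matrix n n ℂ)ᴴ :=
    fun _ => rfl
  rw [contraction, happ, happ]
  split_ifs with htop
  · rfl
  have hs' := supp_le_of_relEnt_ne_top htop
  have hs := (supp_isometry_le_iff hU _ _).1 hs'
  rw [relEnt_of_supp_le hs', relEnt_of_supp_le hs, crossLog_isometry hU _ ρ.2.1.1,
    crossLog_isometry hU _ φ.2.1.1, ← EReal.coe_sub, sub_self, EReal.coe_zero]

theorem logIrr_unitaryChannel [Nonempty n] (U : Matrix.unitaryGroup n ℂ) :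
    logIrr (unitaryChannel U) = 0 := by
  simp only [logIrr, contraction_unitaryChannel, ciSup_const, ciInf_const]

theorem contraction_resetChannel (ρ φ : State (Fin 2)) :
    contraction resetChannel ρ φ = relEnt ρ.1 φ.1 := by
  have happ : ∀ σ : State (Fin 2), (resetChannel.app σ).1 = ketbra0 := by
    intro σ
    change σ.1.trace • ketbra0 = ketbra0
    rw [σ.2.2, one_smul]
  have h : relEnt ketbra0 ketbra0 = 0 := by
    rw [relEnt_of_supp_le le_rfl, sub_self, EReal.coe_zero]
  rw [contraction, happ, happ, h, if_neg EReal.zero_ne_top, sub_zero]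

theorem crossLog_self_nonpos (ρ : State n) : crossLog ρ.1 ρ.1 ≤ 0 := by
  obtain ⟨ρ, hρ, htr⟩ := ρ
  obtain ⟨U, d, rfl⟩ := exists_eq_conjDiag hρ.1
  rw [crossLog_conjDiag]
  refine Finset.sum_nonpos fun i _ => ?_
  rw [weight_self]
  have hd := conjDiag_nonneg hρ
  refine mul_nonpos_of_nonneg_of_nonpos (hd i) (Real.log_nonpos (hd i) ?_)
  rw [← sum_eigenvalues_eq_one htr]
  exact Finset.single_le_sum (fun k _ => hd k) (Finset.mem_univ i)

theorem posSemidef_conjDiag (U : Matrix.unitaryGroup n ℂ) {d : n → ℝ} (hd : ∀ i, 0 ≤ d i) :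
    (conjDiag U d).PosSemidef :=
  (Matrix.PosSemidef.diagonal fun i => by simpa using hd i).mul_mul_conjTranspose_same _

theorem trace_conjDiag (U : Matrix.unitaryGroup n ℂ) (d : n → ℝ) :
    (conjDiag U d).trace = ((∑ i, d i : ℝ) : ℂ) := by
  rw [conjDiag, Matrix.trace_mul_comm, ← Matrix.mul_assoc, Unitary.coe_star_mul_self,
    Matrix.one_mul, Matrix.trace_diagonal, Complex.ofReal_sum]

theorem logIrr_resetChannel : logIrr resetChannel = ((Real.log 2 : ℝ) : EReal) := by
  simp only [logIrr, contraction_resetChannel]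
  refine le_antisymm ?_ (le_iInf fun φ => ?_)
  -- Upper bound from the maximally mixed state: $S(\rho\Vert 1/2)=\ln2-S(\rho)\le\ln2$.
  · set d : Fin 2 → ℝ := fun _ => 1 / 2 with hd
    have htr : (conjDiag (1 : Matrix.unitaryGroup (Fin 2) ℂ) d).trace = 1 := by
      rw [trace_conjDiag]
      norm_num [hd]
    refine iInf_le_of_le ⟨conjDiag 1 d, posSemidef_conjDiag 1 fun i => by norm_num [hd], htr⟩
      (iSup_le fun ρ => ?_)
    have hs : supp ρ.1 ≤ supp (conjDiag 1 d) :=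
      (supp_le_supp_conjDiag_iff ρ.2.1 1 d).2 fun i hi => by norm_num [hd] at hi
    rw [relEnt_of_supp_le hs, EReal.coe_le_coe_iff, crossLog_conjDiag]
    simp only [hd]
    rw [← Finset.sum_mul, sum_weight, ρ.2.2, Complex.one_re, one_mul, one_div, Real.log_inv]
    have := crossLog_self_nonpos ρ
    linarith
  · obtain ⟨φ, hφ, htr⟩ := φ
    obtain ⟨U, d, rfl⟩ := exists_eq_conjDiag hφ.1
    have hsum := sum_eigenvalues_eq_one htr
    -- Lower bound: the eigenprojection `conjDiag U p` at an eigenvalue `d i ≤ 1 / 2` of `φ` is a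
    -- pure state with relative entropy $-\ln d_i\ge\ln2$, infinite if `d i = 0`.
    obtain ⟨i, hi⟩ : ∃ i, d i ≤ 1 / 2 := by
      by_contra! h
      rw [Fin.sum_univ_two] at hsum
      linarith [h 0, h 1]
    set p : Fin 2 → ℝ := Pi.single i 1 with hp
    have hpsd := posSemidef_conjDiag U (d := p) fun k =>
      (Pi.single_nonneg.2 zero_le_one : (0 : Fin 2 → ℝ) ≤ Pi.single i 1) k
    refine le_iSup_of_le ⟨conjDiag U p, hpsd, by rw [trace_conjDiag]; simp [hp]⟩ ?_
    change _ ≤ relEnt (conjDiag U p) (conjDiag U d)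
    by_cases hs : supp (conjDiag U p) ≤ supp (conjDiag U d)
    · have hdi : d i ≠ 0 := fun h0 => by
        have := (supp_le_supp_conjDiag_iff hpsd U d).1 hs i h0
        rw [weight_self] at this
        simp [hp] at this
      have hpos : 0 < d i := (conjDiag_nonneg hφ i).lt_of_ne' hdi
      have h1 : crossLog (conjDiag U p) (conjDiag U p) = 0 := by
        rw [crossLog_conjDiag]
        refine Finset.sum_eq_zero fun k _ => ?_
        by_cases hk : k = i
        · subst hk; simp [hp]
        · simp [hp, hk]
      have h2 : crossLog (conjDiag U p) (conjDiag U d) = Real.log (d i) := by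
        rw [crossLog_conjDiag]
        simp [weight_self, hp, Pi.single_apply]
      rw [relEnt_of_supp_le hs, EReal.coe_le_coe_iff, h1, h2]
      have := Real.log_le_log hpos hi
      rw [one_div, Real.log_inv] at this
      linarith
    · rw [relEnt, if_neg hs]
      exact le_top

end

end LogIrrev

theorem mainTheorem12 :
    (∀ (n m : Type*) [Fintype n] [DecidableEq n] [Nonempty n] [Fintype m] [DecidableEq m]
        (Φ : LogIrrev.Channel n m) (P : LogIrrev.PhysicalProcess Φ),
        ∃ ρ : LogIrrev.State n, LogIrrev.logIrr Φ ≤ P.ep ρ) ∧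
    (∀ (n : Type*) [Fintype n] [DecidableEq n] [Nonempty n] (U : Matrix.unitaryGroup n ℂ),
        LogIrrev.logIrr (LogIrrev.unitaryChannel U) = 0) ∧
    LogIrrev.logIrr LogIrrev.resetChannel = ((Real.log 2 : ℝ) : EReal) ∧
    (∀ P : LogIrrev.PhysicalProcess LogIrrev.resetChannel,
        ∃ ρ : LogIrrev.State (Fin 2), ((Real.log 2 : ℝ) : EReal) ≤ P.ep ρ) := by
  refine ⟨fun n m _ _ _ _ _ Φ P => LogIrrev.exists_logIrr_le_ep Φ P,
    fun n _ _ _ U => LogIrrev.logIrr_unitaryChannel U, LogIrrev.logIrr_resetChannel, fun P => ?_⟩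
  rw [← LogIrrev.logIrr_resetChannel]
  exact LogIrrev.exists_logIrr_le_ep _ P
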